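/- Let $m,N\ge 1$, $d=2^m$, and let $\rho$ be a state of $m$ qubits (a positive semidefinite $d\times d$ matrix with $\operatorname{tr}\rho=1$). At each step $t=1,2,\dots$, independently of all other steps, a Pauli operator $X_t$ is drawn uniformly at random from the $d^2-1$ operators $\sigma_{s_1}\otimes\cdots\otimes\sigma_{s_m}$, $\sigma_{s_k}\in\{I,\sigma_x,\sigma_y,\sigma_z\}$, other than the identity, and it is measured on $N$ copies of $\rho$: given $X_t$, the number $n_t$ of outcomes $+1$ has the binomial distribution $B(N,p)$ with $p=\operatorname{tr}(\rho\,(I+X_t)/2)$. Put $\hat y_t=(2n_t-N)/N$. Let $\hat\rho_1$ be any deterministic positive definite matrix with $\operatorname{tr}\hat\rho_1=1$ (for instance $\hat\rho_1=I/d$), and define the matrix-exponentiated gradient (MEG) estimates by $$\hat\rho_{t+1}=\frac{\exp(G_{t+1})}{\operatorname{tr}\exp(G_{t+1})},\qquad G_{t+1}=\log\hat\rho_t-2\eta_t\bigl(\operatorname{tr}(\hat\rho_tX_t)-\hat y_t\bigr)X_t,$$ with the learning rate, which depends on the true state, $$\eta_t=\frac12\,\frac{\mathbb E\|\hat\rho_t-\rho\|_F^2}{\mathbb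 E\|\hat\rho_t-\rho\|_F^2+2\,\frac{d^2-1}{Nd}},$$ where $\|\cdot\|_F$ is the Frobenius norm and $\mathbb E$ is the expectation over all measurement choices and outcomes. Then $\hat\rho_t$ converges to $\rho$ in probability: for every $\delta>0$, $$\lim_{t\to\infty}\Pr\bigl\{\|\hat\rho_t-\rho\|_F^2\le\delta\bigr\}=1.$$ -/

import Mathlib

open MeasureTheory ProbabilityTheory Filter Topology
open scoped ComplexOrder

namespace MEG

/-- Computational basis of `m` qubits; it has `2 ^ m` elements. -/
abbrev QubitBasis (m : ℕ) : Type := Fin m → Fin 2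

/-- Operators on the `2 ^ m`-dimensional Hilbert space of `m` qubits. -/
abbrev QubitOp (m : ℕ) : Type := Matrix (QubitBasis m) (QubitBasis m) ℂ

/-- The dimension `d = 2 ^ m`, as a real number. -/
def dim (m : ℕ) : ℝ := 2 ^ m

/-- Quantum states: positive semidefinite operators of trace one. -/
def IsState {m : ℕ} (ρ : QubitOp m) : Prop := ρ.PosSemidef ∧ ρ.trace = 1

/-- The one-qubit Pauli matrices `I, σ_x, σ_y, σ_z`, in this order. -/
def pauli : Fin 4 → Matrix (Fin 2) (Fin 2) ℂ :=
  ![!![1, 0; 0, 1], !![0, 1; 1, 0], !![0, -Complex.I; Complex.I, 0], !![1, 0; 0, -1]]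

/-- The `m`-qubit Pauli operator `σ_{s 0} ⊗ ⋯ ⊗ σ_{s (m - 1)}`, by its matrix entries. -/
def pauliString {m : ℕ} (s : Fin m → Fin 4) : QubitOp m :=
  Matrix.of fun a b => ∏ k, pauli (s k) (a k) (b k)

/-- Labels of the `4 ^ m - 1 = d ^ 2 - 1` Pauli operators other than the identity. -/
abbrev PauliIndex (m : ℕ) : Type := {s : Fin m → Fin 4 // s ≠ 0}

/-- The projector `(I + X) / 2` onto the `+1` eigenspace of an operator `X` with `X ^ 2 = I`. -/
noncomputable def upProjector {m : ℕ} (X : QubitOp m) : QubitOp m := (1 / 2 : ℝ) • (1 + X)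

/-- Born rule: the probability `tr (ρ Π_up)` of the outcome "up" when `X` is measured on `ρ`. -/
noncomputable def upProb {m : ℕ} (ρ X : QubitOp m) : ℝ := (ρ * upProjector X).trace.re

/-- The mass that the binomial distribution `B(N, p)` gives to `k`. -/
noncomputable def binomialMass (N : ℕ) (p : ℝ) (k : ℕ) : ℝ :=
  (N.choose k : ℝ) * p ^ k * (1 - p) ^ (N - k)

/-- A sequence of `N`-shot Pauli measurements of the state `ρ`. At step `t` the operator with label
`choice t` is measured on `N` fresh copies of `ρ`, and `up t` is the number of "up" outcomes. The
steps are independent; in each of them the label is uniform on the `d ^ 2 - 1` non-identity Pauli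
operators `X` and, given the label, the number of "up" outcomes is `B(N, tr (ρ Π_up))`. -/
structure IsPauliMeasurementSequence {m : ℕ} {Ω : Type*} [MeasurableSpace Ω] (μ : Measure Ω)
    (ρ : QubitOp m) (N : ℕ) (choice : ℕ → Ω → PauliIndex m) (up : ℕ → Ω → ℕ) : Prop where
  measurable_choice : ∀ t, Measurable (choice t)
  measurable_up : ∀ t, Measurable (up t)
  indep : iIndepFun (fun t ω => (choice t ω, up t ω)) μ
  law : ∀ (t : ℕ) (s : PauliIndex m) (k : ℕ),
    μ {ω | choice t ω = s ∧ up t ω = k} =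
      ENNReal.ofReal (1 / (dim m ^ 2 - 1) * binomialMass N (upProb ρ (pauliString s.1)) k)

/-- The observed average `(n_up - n_down) / N = (2 n_up - N) / N`. -/
noncomputable def outcomeAverage (N n : ℕ) : ℝ := (2 * (n : ℝ) - N) / N

/-- The matrix-exponentiated gradient update of the estimate `σ` for the observable `X`, the
measured average `y` and the learning rate `η`:
`exp G / tr (exp G)` with `G = log σ - 2 η (tr (σ X) - y) X`. -/
noncomputable def update {m : ℕ} (σ X : QubitOp m) (y η : ℝ) : QubitOp m :=
  let G : QubitOp m := cfc Real.log σ - (2 * η * ((σ * X).trace.re - y)) • X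
  (NormedSpace.exp G).trace⁻¹ • NormedSpace.exp G

/-- The square of the Frobenius norm. -/
noncomputable def frobeniusSq {m : ℕ} (A : QubitOp m) : ℝ := ∑ a, ∑ b, ‖A a b‖ ^ 2

/-- The learning rate `(1 / 2) e / (e + 2 (d ^ 2 - 1) / (N d))`, where `e` is the current mean
squared error. -/
noncomputable def adaptiveRate (m N : ℕ) (e : ℝ) : ℝ :=
  1 / 2 * (e / (e + 2 * ((dim m ^ 2 - 1) / (N * dim m))))

/-- The random estimates produced by the update rule from the initial estimate `ρ₁`. Step `t` uses
the deterministic learning rate computed from the mean squared error `E ‖ρ̂_t - ρ‖_F ^ 2`. Steps are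
numbered from `0`. -/
noncomputable def estimate {m : ℕ} {Ω : Type*} [MeasurableSpace Ω] (μ : Measure Ω)
    (ρ ρ₁ : QubitOp m) (N : ℕ) (choice : ℕ → Ω → PauliIndex m) (up : ℕ → Ω → ℕ) :
    ℕ → Ω → QubitOp m
  | 0 => fun _ => ρ₁
  | t + 1 => fun ω =>
      update (estimate μ ρ ρ₁ N choice up t ω) (pauliString (choice t ω).1)
        (outcomeAverage N (up t ω))
        (adaptiveRate m N (∫ ω', frobeniusSq (estimate μ ρ ρ₁ N choice up t ω' - ρ) ∂μ))

end MEG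

/-! The cross entropy `-tr (ρ log ρ̂_t)` is a Lyapunov function. It stays nonnegative, and unlike
the relative entropy it involves no logarithm of the possibly singular `ρ`. Since `log ρ̂_{t+1}` is
`log ρ̂_t - a X` minus the log-partition function, everything rests on the bound `log Z ≤ -a tr
(ρ̂_t X) + a ^ 2` (`log_trace_exp_le`), which is dual to a Pinsker-type inequality for the
observable `X` (`sq_trace_sub_mul_le_relEntropy`).

With `a = 2 η (x - ŷ)`, where `x = tr (ρ̂_t X)`, averaging over the outcome uses that `ŷ` is
unbiased with variance at most `1 / N`. Averaging over `X` turns the squared deviations into the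
squared Frobenius error by Parseval (`stepMean_crossEntropy_update_le`). The prescribed rate makes
the expected decrease at least `K e_t ^ 2`, where `e_t` is the mean squared error
(`adaptiveRate_gain`). A nonnegative potential can lose only a finite total, so `∑ e_t ^ 2`
converges and `e_t → 0`. Markov's inequality then gives convergence in probability. -/

namespace MEG

/-! ### Pinsker-type inequality for quantum relative entropy -/

section Matrices

open Matrix

variable {n : Type*} [Fintype n] [DecidableEq n]

/-- The classical Pinsker-type bound, termwise: it goes through the squared Hellinger distance. -/
lemma sq_sub_div_le_klTerm {p q : ℝ} (hp : 0 < p) (hq : 0 < q) :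
    (p - q) ^ 2 / (2 * (p + q)) ≤ p * Real.log p - p * Real.log q - p + q := by
  obtain ⟨a, ha, rfl⟩ : ∃ a : ℝ, 0 < a ∧ p = a ^ 2 :=
    ⟨√p, Real.sqrt_pos.2 hp, (Real.sq_sqrt hp.le).symm⟩
  obtain ⟨b, hb, rfl⟩ : ∃ b : ℝ, 0 < b ∧ q = b ^ 2 :=
    ⟨√q, Real.sqrt_pos.2 hq, (Real.sq_sqrt hq.le).symm⟩
  have hlog : Real.log b - Real.log a ≤ b / a - 1 := by
    rw [← Real.log_div hb.ne' ha.ne']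
    exact Real.log_le_sub_one_of_pos (div_pos hb ha)
  have hmul : a ^ 2 * (Real.log b - Real.log a) ≤ a * b - a ^ 2 := by
    calc a ^ 2 * (Real.log b - Real.log a) ≤ a ^ 2 * (b / a - 1) := by gcongr
      _ = a * b - a ^ 2 := by field_simp
  -- `(a + b) ^ 2 ≤ 2 (a ^ 2 + b ^ 2)`; on the other side, `hmul` bounds the entropy term below by
  -- `(a - b) ^ 2`.
  have hsq : (a ^ 2 - b ^ 2) ^ 2 / (2 * (a ^ 2 + b ^ 2)) ≤ (a - b) ^ 2 := by
    rw [div_le_iff₀ (by positivity)]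
    nlinarith [mul_nonneg (sq_nonneg (a - b)) (sq_nonneg (a - b))]
  rw [Real.log_pow, Real.log_pow]
  push_cast
  linarith

/-- One `U` serves every `f`, so a matrix and its logarithm are diagonalized together. -/
lemma _root_.Matrix.IsHermitian.exists_unitary_diagonalization {A : Matrix n n ℂ}
    (hA : A.IsHermitian) :
    ∃ U : Matrix n n ℂ, Uᴴ * U = 1 ∧ U * Uᴴ = 1 ∧ ∀ f : ℝ → ℝ,
      cfc f A = U * diagonal (fun i => (f (hA.eigenvalues i) : ℂ)) * Uᴴ := by
  refine ⟨hA.eigenvectorUnitary, ?_, ?_, fun f => ?_⟩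
  · exact Unitary.coe_star_mul_self _
  · exact Unitary.coe_mul_star_self _
  · rw [hA.cfc_eq, Matrix.IsHermitian.cfc, Unitary.conjStarAlgAut_apply]
    rfl

lemma _root_.Matrix.PosDef.exists_unitary_diagonalization {A : Matrix n n ℂ} (hA : A.PosDef) :
    ∃ (U : Matrix n n ℂ) (p : n → ℝ), Uᴴ * U = 1 ∧ U * Uᴴ = 1 ∧ (∀ i, 0 < p i) ∧
      A = U * diagonal (fun i => (p i : ℂ)) * Uᴴ ∧
      cfc Real.log A = U * diagonal (fun i => (Real.log (p i) : ℂ)) * Uᴴ := by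
  obtain ⟨U, h₁, h₂, h⟩ := hA.isHermitian.exists_unitary_diagonalization
  refine ⟨U, _, h₁, h₂, hA.eigenvalues_pos, ?_, h _⟩
  have := h id
  rwa [cfc_id ℝ A hA.isHermitian.isSelfAdjoint] at this

lemma trace_diagonal_mul_mul (v : n → ℂ) (A B : Matrix n n ℂ) :
    (diagonal v * A * B).trace = ∑ i, ∑ j, v i * (A i j * B j i) := by
  simp_rw [Matrix.mul_assoc, trace, diag_apply, diagonal_mul, mul_apply, Finset.mul_sum]

lemma sum_normSq_row {W : Matrix n n ℂ} (h : W * Wᴴ = 1) (i : n) : ∑ j, ‖W i j‖ ^ 2 = 1 := by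
  have h1 : (W * Wᴴ) i i = 1 := by rw [h, one_apply_eq]
  have h2 : ((∑ j, ‖W i j‖ ^ 2 : ℝ) : ℂ) = 1 := by
    rw [← h1, mul_apply]
    push_cast
    exact Finset.sum_congr rfl fun j _ => by
      rw [conjTranspose_apply, Complex.star_def, Complex.mul_conj']
  exact_mod_cast h2

lemma sum_normSq_col {W : Matrix n n ℂ} (h : Wᴴ * W = 1) (j : n) : ∑ i, ‖W i j‖ ^ 2 = 1 := by
  simpa using sum_normSq_row (W := Wᴴ) (by simpa using h) j

/-- A weak quantum Pinsker inequality, tested against an involution `X`: a fluctuation of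
`tr (σ X)` is controlled by the quantum relative entropy. -/
theorem sq_trace_sub_mul_le_relEntropy {σ τ X : Matrix n n ℂ} (hσ : σ.PosDef) (hτ : τ.PosDef)
    (hσ₁ : σ.trace = 1) (hτ₁ : τ.trace = 1) (hX : X.IsHermitian) (hX₁ : X * X = 1) :
    1 / 4 * ((σ * X).trace.re - (τ * X).trace.re) ^ 2 ≤
      (σ * (cfc Real.log σ - cfc Real.log τ)).trace.re := by
  obtain ⟨U, p, hU, hU', hp, rfl, hσl⟩ := hσ.exists_unitary_diagonalization
  obtain ⟨V, q, hV, hV', hq, rfl, hτl⟩ := hτ.exists_unitary_diagonalization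
  rw [hσl, hτl]
  -- `W` holds the overlaps of the two eigenbases and `Y` the entries of `X` between them. Both are
  -- unitary, so their squared moduli are doubly stochastic.
  set W : Matrix n n ℂ := Uᴴ * V with hW
  set Y : Matrix n n ℂ := Vᴴ * X * U with hY
  have hWl : Wᴴ * W = 1 := by
    rw [hW, conjTranspose_mul, conjTranspose_conjTranspose,
      show Vᴴ * U * (Uᴴ * V) = Vᴴ * (U * Uᴴ) * V by noncomm_ring, hU', mul_one, hV]
  have hWr : W * Wᴴ = 1 := by
    rw [hW, conjTranspose_mul, conjTranspose_conjTranspose,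
      show Uᴴ * V * (Vᴴ * U) = Uᴴ * (V * Vᴴ) * U by noncomm_ring, hV', mul_one, hU]
  have hYl : Yᴴ * Y = 1 := by
    rw [hY, conjTranspose_mul, conjTranspose_mul, conjTranspose_conjTranspose, hX.eq,
      show Uᴴ * (X * V) * (Vᴴ * X * U) = Uᴴ * (X * (V * Vᴴ) * X) * U by noncomm_ring, hV', mul_one,
      hX₁, mul_one, hU]
  have hYr : Y * Yᴴ = 1 := by
    rw [hY, conjTranspose_mul, conjTranspose_mul, conjTranspose_conjTranspose, hX.eq,
      show Vᴴ * X * U * (Uᴴ * (X * V)) = Vᴴ * (X * (U * Uᴴ) * X) * V by noncomm_ring, hU', mul_one,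
      hX₁, mul_one, hV]
  have hconj (S : Matrix n n ℂ) (hS : Sᴴ * S = 1) (v : n → ℂ) :
      (S * diagonal v * Sᴴ).trace = ∑ i, v i := by
    rw [trace_mul_cycle, hS, one_mul, trace_diagonal]
  have hsp : ∑ i, p i = 1 := by
    rw [hconj U hU] at hσ₁
    exact_mod_cast hσ₁
  have hsq : ∑ i, q i = 1 := by
    rw [hconj V hV] at hτ₁
    exact_mod_cast hτ₁
  have hWr' := sum_normSq_row hWr
  have hWl' := sum_normSq_col hWl
  have hYr' := sum_normSq_row hYr
  have hYl' := sum_normSq_col hYl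
  have e1 : (U * diagonal (fun i => (p i : ℂ)) * Uᴴ * X).trace =
      ∑ i, ∑ j, (p i : ℂ) * (W i j * Y j i) := by
    rw [← trace_diagonal_mul_mul, hW, hY,
      show diagonal (fun i => (p i : ℂ)) * (Uᴴ * V) * (Vᴴ * X * U) =
        diagonal (fun i => (p i : ℂ)) * Uᴴ * ((V * Vᴴ) * X) * U by noncomm_ring, hV', one_mul,
      trace_mul_comm _ U]
    congr 1
    noncomm_ring
  have e2 : (V * diagonal (fun i => (q i : ℂ)) * Vᴴ * X).trace =
      ∑ i, ∑ j, (q j : ℂ) * (W i j * Y j i) := by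
    rw [Finset.sum_comm]
    simp_rw [mul_comm (W _ _)]
    rw [← trace_diagonal_mul_mul, hW, hY,
      show diagonal (fun i => (q i : ℂ)) * (Vᴴ * X * U) * (Uᴴ * V) =
        diagonal (fun i => (q i : ℂ)) * Vᴴ * (X * (U * Uᴴ)) * V by noncomm_ring, hU', mul_one,
      trace_mul_comm _ V]
    congr 1
    noncomm_ring
  have e3 : (U * diagonal (fun i => (p i : ℂ)) * Uᴴ *
      (U * diagonal (fun i => (Real.log (p i) : ℂ)) * Uᴴ)).trace =
      ((∑ i, p i * Real.log (p i) : ℝ) : ℂ) := by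
    rw [show U * diagonal (fun i => (p i : ℂ)) * Uᴴ *
        (U * diagonal (fun i => (Real.log (p i) : ℂ)) * Uᴴ) =
        U * (diagonal (fun i => (p i : ℂ)) * (Uᴴ * U) *
          diagonal (fun i => (Real.log (p i) : ℂ))) * Uᴴ by noncomm_ring, hU, mul_one,
      diagonal_mul_diagonal, hconj U hU]
    push_cast
    rfl
  have e4 : (U * diagonal (fun i => (p i : ℂ)) * Uᴴ *
      (V * diagonal (fun i => (Real.log (q i) : ℂ)) * Vᴴ)).trace =
      ((∑ i, ∑ j, p i * Real.log (q j) * ‖W i j‖ ^ 2 : ℝ) : ℂ) := by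
    have : (U * diagonal (fun i => (p i : ℂ)) * Uᴴ *
        (V * diagonal (fun i => (Real.log (q i) : ℂ)) * Vᴴ)).trace =
        (diagonal (fun i => (p i : ℂ)) * W *
          (diagonal (fun i => (Real.log (q i) : ℂ)) * Wᴴ)).trace := by
      rw [hW, conjTranspose_mul, conjTranspose_conjTranspose,
        show diagonal (fun i => (p i : ℂ)) * (Uᴴ * V) *
          (diagonal (fun i => (Real.log (q i) : ℂ)) * (Vᴴ * U)) =
          diagonal (fun i => (p i : ℂ)) * Uᴴ *
            (V * diagonal (fun i => (Real.log (q i) : ℂ)) * Vᴴ) * U by noncomm_ring,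
        trace_mul_comm _ U]
      congr 1
      noncomm_ring
    rw [this, trace_diagonal_mul_mul]
    push_cast
    refine Finset.sum_congr rfl fun i _ => Finset.sum_congr rfl fun j _ => ?_
    rw [diagonal_mul, conjTranspose_apply, Complex.star_def, ← Complex.mul_conj']
    ring
  -- The added `-p + q` has total weight zero, as both traces are one; it makes every summand
  -- nonnegative.
  have hent : (U * diagonal (fun i => (p i : ℂ)) * Uᴴ *
      (U * diagonal (fun i => (Real.log (p i) : ℂ)) * Uᴴ -
        V * diagonal (fun i => (Real.log (q i) : ℂ)) * Vᴴ)).trace.re =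
      ∑ i, ∑ j, (p i * Real.log (p i) - p i * Real.log (q j) - p i + q j) * ‖W i j‖ ^ 2 := by
    rw [mul_sub, trace_sub, e3, e4, ← Complex.ofReal_sub, Complex.ofReal_re]
    have h1 : ∑ i, ∑ j, p i * Real.log (p i) * ‖W i j‖ ^ 2 = ∑ i, p i * Real.log (p i) := by
      simp_rw [← Finset.mul_sum, hWr', mul_one]
    have h2 : ∑ i, ∑ j, p i * ‖W i j‖ ^ 2 = 1 := by
      simp_rw [← Finset.mul_sum, hWr', mul_one, hsp]
    have h3 : ∑ i, ∑ j, q j * ‖W i j‖ ^ 2 = 1 := by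
      rw [Finset.sum_comm]
      simp_rw [← Finset.mul_sum, hWl', mul_one, hsq]
    simp_rw [add_mul, sub_mul, Finset.sum_add_distrib, Finset.sum_sub_distrib]
    rw [h1, h2, h3]
    ring
  have hdiff : (U * diagonal (fun i => (p i : ℂ)) * Uᴴ * X).trace.re -
      (V * diagonal (fun i => (q i : ℂ)) * Vᴴ * X).trace.re =
      ∑ i, ∑ j, (p i - q j) * (W i j * Y j i).re := by
    rw [e1, e2]
    simp only [Complex.re_sum, Complex.re_ofReal_mul, ← Finset.sum_sub_distrib, sub_mul]
  have hmass : ∑ i, ∑ j, (p i + q j) / 2 * ‖Y j i‖ ^ 2 = 1 := by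
    have h2 : ∑ i, ∑ j, p i / 2 * ‖Y j i‖ ^ 2 = 1 / 2 := by
      simp_rw [← Finset.mul_sum, hYl', mul_one, ← Finset.sum_div, hsp]
    have h3 : ∑ i, ∑ j, q j / 2 * ‖Y j i‖ ^ 2 = 1 / 2 := by
      rw [Finset.sum_comm]
      simp_rw [← Finset.mul_sum, hYr', mul_one, ← Finset.sum_div, hsq]
    simp_rw [add_div, add_mul, Finset.sum_add_distrib]
    rw [h2, h3]
    norm_num
  rw [hent, hdiff]
  -- Cauchy–Schwarz, with the second factor normalized to mass one by `hmass`. The 4 is the `2 (p +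
  -- q)` of the scalar bound divided by the weight `(p + q) / 2`.
  have hcs := Finset.sum_sq_le_sum_mul_sum_of_sq_le_mul (Finset.univ : Finset (n × n))
    (r := fun x => (p x.1 - q x.2) * (W x.1 x.2 * Y x.2 x.1).re)
    (f := fun x => 4 * ((p x.1 * Real.log (p x.1) - p x.1 * Real.log (q x.2) - p x.1 + q x.2) *
      ‖W x.1 x.2‖ ^ 2))
    (g := fun x => (p x.1 + q x.2) / 2 * ‖Y x.2 x.1‖ ^ 2) ?_ ?_ ?_
  · rw [← Finset.mul_sum] at hcs
    simp only [Fintype.sum_prod_type] at hcs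
    rw [hmass] at hcs
    linarith
  · intro x _
    have := sq_sub_div_le_klTerm (hp x.1) (hq x.2)
    have h0 : 0 ≤ (p x.1 - q x.2) ^ 2 / (2 * (p x.1 + q x.2)) := by
      have := hp x.1; have := hq x.2
      positivity
    have := h0.trans this
    positivity
  · intro x _
    have := hp x.1; have := hq x.2
    positivity
  · intro x _
    have h0 := hp x.1
    have h1 := hq x.2
    have h2 := sq_sub_div_le_klTerm h0 h1
    rw [div_le_iff₀ (by positivity)] at h2
    have h3 : (W x.1 x.2 * Y x.2 x.1).re ^ 2 ≤ ‖W x.1 x.2‖ ^ 2 * ‖Y x.2 x.1‖ ^ 2 := by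
      rw [← mul_pow, ← norm_mul]
      exact sq_le_sq.2 ((Complex.abs_re_le_norm _).trans (le_abs_self _))
    calc ((p x.1 - q x.2) * (W x.1 x.2 * Y x.2 x.1).re) ^ 2
        = (p x.1 - q x.2) ^ 2 * (W x.1 x.2 * Y x.2 x.1).re ^ 2 := by ring
      _ ≤ (p x.1 - q x.2) ^ 2 * (‖W x.1 x.2‖ ^ 2 * ‖Y x.2 x.1‖ ^ 2) := by gcongr
      _ ≤ ((p x.1 * Real.log (p x.1) - p x.1 * Real.log (q x.2) - p x.1 + q x.2) *
            (2 * (p x.1 + q x.2))) * (‖W x.1 x.2‖ ^ 2 * ‖Y x.2 x.1‖ ^ 2) := by gcongr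
      _ = _ := by ring

end Matrices

/-! ### Gibbs states and the free energy bound -/

section Gibbs

open Matrix

variable {n : Type*} [Fintype n] [DecidableEq n]

lemma _root_.Matrix.IsHermitian.posDef_exp {G : Matrix n n ℂ} (hG : G.IsHermitian) :
    (NormedSpace.exp G).PosDef := by
  have hH : ((1 / 2 : ℝ) • G).IsHermitian := hG.smul (IsSelfAdjoint.all _)
  have h : NormedSpace.exp G =
      (NormedSpace.exp ((1 / 2 : ℝ) • G))ᴴ * NormedSpace.exp ((1 / 2 : ℝ) • G) := by
    rw [hH.exp.eq, ← Matrix.exp_add_of_commute _ _ (Commute.refl _), ← add_smul]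
    norm_num
  rw [h]
  exact Matrix.PosDef.conjTranspose_mul_self _
    (mulVec_injective_of_isUnit (Matrix.isUnit_exp _))

-- The operator norm supplies the normed algebra structure used by `CFC.log_smul` and `CFC.log_exp`.
open scoped Matrix.Norms.L2Operator in
lemma _root_.Matrix.IsHermitian.cfc_log_smul_exp {G : Matrix n n ℂ} (hG : G.IsHermitian) {r : ℝ}
    (hr : 0 < r) :
    cfc Real.log (r • NormedSpace.exp G) = G + Real.log r • (1 : Matrix n n ℂ) := by
  have hpos := hG.posDef_exp
  have h := CFC.log_smul (r := r) (NormedSpace.exp G) (fun x hx => ?_) hr.ne'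
    hpos.isHermitian.isSelfAdjoint
  · rw [CFC.log_exp G hG.isSelfAdjoint, Algebra.algebraMap_eq_smul_one, add_comm] at h
    exact h
  · rw [hpos.isHermitian.spectrum_real_eq_range_eigenvalues] at hx
    obtain ⟨i, rfl⟩ := hx
    exact (hpos.eigenvalues_pos i).ne'

/-- The exponential of a Hermitian matrix, normalized to have trace one. -/
noncomputable def gibbs (G : Matrix n n ℂ) : Matrix n n ℂ :=
  (NormedSpace.exp G).trace⁻¹ • NormedSpace.exp G

lemma trace_exp_re_pos [Nonempty n] {G : Matrix n n ℂ} (hG : G.IsHermitian) :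
    0 < (NormedSpace.exp G).trace.re :=
  (Complex.lt_def.1 hG.posDef_exp.trace_pos).1

lemma gibbs_eq [Nonempty n] {G : Matrix n n ℂ} (hG : G.IsHermitian) :
    gibbs G = (NormedSpace.exp G).trace.re⁻¹ • NormedSpace.exp G := by
  have h : (NormedSpace.exp G).trace = ((NormedSpace.exp G).trace.re : ℂ) :=
    Complex.ext rfl (Complex.lt_def.1 hG.posDef_exp.trace_pos).2.symm
  rw [gibbs, h, ← Complex.ofReal_inv, Complex.ofReal_re, Complex.coe_smul]

lemma gibbs_posDef [Nonempty n] {G : Matrix n n ℂ} (hG : G.IsHermitian) : (gibbs G).PosDef := by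
  rw [gibbs_eq hG]
  exact hG.posDef_exp.smul (inv_pos.2 (trace_exp_re_pos hG))

lemma gibbs_trace [Nonempty n] {G : Matrix n n ℂ} (hG : G.IsHermitian) : (gibbs G).trace = 1 := by
  rw [gibbs, trace_smul, smul_eq_mul, inv_mul_cancel₀ hG.posDef_exp.trace_pos.ne']

lemma cfc_log_gibbs [Nonempty n] {G : Matrix n n ℂ} (hG : G.IsHermitian) :
    cfc Real.log (gibbs G) =
      G - Real.log (NormedSpace.exp G).trace.re • (1 : Matrix n n ℂ) := by
  rw [gibbs_eq hG, hG.cfc_log_smul_exp (inv_pos.2 (trace_exp_re_pos hG)), Real.log_inv, neg_smul,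
    sub_eq_add_neg]

lemma isHermitian_cfc_log (A : Matrix n n ℂ) : (cfc Real.log A).IsHermitian :=
  (cfc_predicate Real.log A : IsSelfAdjoint (cfc Real.log A))

lemma isHermitian_cfc_log_sub_smul (A : Matrix n n ℂ) {X : Matrix n n ℂ} (hX : X.IsHermitian)
    (a : ℝ) : (cfc Real.log A - a • X).IsHermitian :=
  (isHermitian_cfc_log A).sub (hX.smul (IsSelfAdjoint.all _))

/-- A quadratic bound for the free energy of a state perturbed by an involution. -/
theorem log_trace_exp_le [Nonempty n] {τ X : Matrix n n ℂ} (hτ : τ.PosDef) (hτ₁ : τ.trace = 1)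
    (hX : X.IsHermitian) (hX₁ : X * X = 1) (a : ℝ) :
    Real.log (NormedSpace.exp (cfc Real.log τ - a • X)).trace.re ≤
      -(a * (τ * X).trace.re) + a ^ 2 := by
  have hG := isHermitian_cfc_log_sub_smul τ hX a
  set G := cfc Real.log τ - a • X with hGdef
  have hmain := sq_trace_sub_mul_le_relEntropy (gibbs_posDef hG) hτ (gibbs_trace hG) hτ₁ hX hX₁
  have hdiff : cfc Real.log (gibbs G) - cfc Real.log τ =
      -(a • X) - Real.log (NormedSpace.exp G).trace.re • (1 : Matrix n n ℂ) := by
    rw [cfc_log_gibbs hG]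
    conv_lhs => rw [hGdef]
    abel
  rw [hdiff, mul_sub, mul_neg, mul_smul_comm, mul_smul_comm, mul_one, trace_sub, trace_neg,
    trace_smul, trace_smul, gibbs_trace hG, Complex.sub_re, Complex.neg_re, Complex.smul_re,
    Complex.smul_re, Complex.one_re, smul_eq_mul, smul_eq_mul] at hmain
  -- With `u = tr (gibbs G X) - tr (τ X)`, `hmain` reads `log Z ≤ -a tr (τ X) - a u - u ^ 2 / 4`;
  -- completing the square removes `u`.
  nlinarith [sq_nonneg ((gibbs G * X).trace.re - (τ * X).trace.re + 2 * a)]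

/-- The cross entropy of two states is nonnegative. -/
theorem trace_mul_log_nonpos {ρ τ : Matrix n n ℂ} (hρ : ρ.PosSemidef) (hτ : τ.PosDef)
    (hτ₁ : τ.trace = 1) : (ρ * cfc Real.log τ).trace.re ≤ 0 := by
  obtain ⟨V, q, hV, hV', hq, rfl, hτl⟩ := hτ.exists_unitary_diagonalization
  rw [hτl]
  have hsq : ∑ i, q i = 1 := by
    rw [trace_mul_cycle, hV, one_mul, trace_diagonal] at hτ₁
    exact_mod_cast hτ₁
  have h : (ρ * (V * diagonal (fun i => (Real.log (q i) : ℂ)) * Vᴴ)).trace =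
      ∑ i, (Real.log (q i) : ℂ) * (Vᴴ * ρ * V) i i := by
    rw [show ρ * (V * diagonal (fun i => (Real.log (q i) : ℂ)) * Vᴴ) =
      ρ * V * (diagonal (fun i => (Real.log (q i) : ℂ)) * Vᴴ) by noncomm_ring, trace_mul_comm,
      Matrix.mul_assoc]
    simp_rw [trace, diag_apply, diagonal_mul, Matrix.mul_assoc]
  rw [h, Complex.re_sum]
  refine Finset.sum_nonpos fun i _ => ?_
  rw [Complex.re_ofReal_mul]
  have h1 : q i ≤ 1 := hsq ▸ Finset.single_le_sum (fun j _ => (hq j).le) (Finset.mem_univ i)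
  have h2 : 0 ≤ ((Vᴴ * ρ * V) i i).re :=
    (Complex.le_def.1 (hρ.conjTranspose_mul_mul_same V).diag_nonneg).1
  exact mul_nonpos_of_nonpos_of_nonneg (Real.log_nonpos (hq i).le h1) h2

/-- Expectation values of an involution in a state lie in `[-1, 1]`. -/
theorem abs_trace_mul_le_one {ρ X : Matrix n n ℂ} (hρ : ρ.PosSemidef) (hρ₁ : ρ.trace = 1)
    (hX : X.IsHermitian) (hX₁ : X * X = 1) : |(ρ * X).trace.re| ≤ 1 := by
  have key (Y : Matrix n n ℂ) (hY : Y.IsHermitian) (hY₁ : Y * Y = 1) :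
      0 ≤ 1 + (ρ * Y).trace.re := by
    have h0 : 0 ≤ ((1 + Y)ᴴ * ρ * (1 + Y)).trace.re :=
      (Complex.le_def.1 (hρ.conjTranspose_mul_mul_same (1 + Y)).trace_nonneg).1
    -- `Y` is an involution, so `(1 + Y) ^ 2 = 2 (1 + Y)`.
    have h1 : ((1 + Y)ᴴ * ρ * (1 + Y)).trace = 2 * (1 + (ρ * Y).trace) := by
      rw [trace_mul_comm, ← Matrix.mul_assoc, conjTranspose_add, conjTranspose_one, hY.eq,
        show (1 + Y) * (1 + Y) * ρ = ρ + (2 : ℂ) • (Y * ρ) + (Y * Y) * ρ by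
          rw [two_smul]; noncomm_ring, hY₁, one_mul, trace_add, trace_add, trace_smul,
        trace_mul_comm Y, hρ₁, smul_eq_mul]
      ring
    rw [h1] at h0
    simp at h0
    linarith
  rw [abs_le]
  have h1 := key X hX hX₁
  have h2 := key (-X) hX.neg (by rw [neg_mul_neg, hX₁])
  rw [mul_neg, trace_neg, Complex.neg_re] at h2
  constructor <;> linarith

end Gibbs

/-! ### Pauli operators and Parseval's identity -/

section Pauli

open Matrix

variable {m : ℕ}

lemma pauli_isHermitian (i : Fin 4) (a b : Fin 2) : star (pauli i a b) = pauli i b a := by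
  fin_cases i <;> fin_cases a <;> fin_cases b <;> simp [pauli]

lemma pauli_mul_self (i : Fin 4) : pauli i * pauli i = 1 := by
  fin_cases i <;> ext a b <;> fin_cases a <;> fin_cases b <;> simp [pauli]

/-- Completeness, rather than orthogonality, is the form from which Parseval follows at once; it
passes to `m` qubits by expanding a product of sums. -/
lemma pauli_completeness (a b c e : Fin 2) :
    ∑ i, pauli i b a * star (pauli i e c) = if a = c ∧ b = e then 2 else 0 := by
  rw [Fin.sum_univ_four]
  fin_cases a <;> fin_cases b <;> fin_cases c <;> fin_cases e <;> simp [pauli] <;> norm_num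

lemma pauliString_isHermitian (s : Fin m → Fin 4) : (pauliString s).IsHermitian := by
  ext a b
  simp only [conjTranspose_apply, pauliString, of_apply, star_prod (R := ℂ), pauli_isHermitian]

lemma prod_ite_eq_fun {ι α R : Type*} [Fintype ι] [DecidableEq ι] [DecidableEq α]
    [CommSemiring R] (a b : ι → α) :
    (∏ k, if a k = b k then (1 : R) else 0) = if a = b then 1 else 0 := by
  rw [Finset.prod_ite_zero]
  simp [funext_iff]

lemma pauliString_mul_self (s : Fin m → Fin 4) : pauliString s * pauliString s = 1 := by
  ext a b
  have h (k : Fin m) :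
      ∑ j, pauli (s k) (a k) j * pauli (s k) j (b k) = if a k = b k then 1 else 0 := by
    rw [← mul_apply, pauli_mul_self, one_apply]
  rw [mul_apply, one_apply, ← prod_ite_eq_fun]
  simp_rw [← h, pauliString, of_apply, ← Finset.prod_mul_distrib]
  rw [Finset.prod_univ_sum, Fintype.piFinset_univ]

lemma pauliString_zero : pauliString (0 : Fin m → Fin 4) = 1 := by
  ext a b
  rw [one_apply, ← prod_ite_eq_fun a b, pauliString, of_apply]
  refine Finset.prod_congr rfl fun k _ => ?_
  have h : pauli 0 = 1 := by
    ext i j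
    fin_cases i <;> fin_cases j <;> simp [pauli]
  rw [Pi.zero_apply, h, one_apply]

lemma pauliString_completeness (a b c e : QubitBasis m) :
    ∑ s : Fin m → Fin 4, pauliString s b a * star (pauliString s e c) =
      if a = c ∧ b = e then 2 ^ m else 0 := by
  have h : (if a = c ∧ b = e then (2 : ℂ) ^ m else 0) =
      ∏ k, if a k = c k ∧ b k = e k then (2 : ℂ) else 0 := by
    rw [Finset.prod_ite_zero]
    simp [funext_iff, forall_and]
  simp_rw [h, ← pauli_completeness, pauliString, of_apply, star_prod, ← Finset.prod_mul_distrib]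
  rw [Finset.prod_univ_sum, Fintype.piFinset_univ]

/-- Parseval's identity for the Pauli basis. -/
lemma sum_normSq_trace_mul_pauliString (A : QubitOp m) :
    ∑ s : Fin m → Fin 4, ‖(A * pauliString s).trace‖ ^ 2 = dim m * frobeniusSq A := by
  have htr (s : Fin m → Fin 4) : (A * pauliString s).trace =
      ∑ x : QubitBasis m × QubitBasis m, A x.1 x.2 * pauliString s x.2 x.1 := by
    rw [Fintype.sum_prod_type]
    simp only [trace, diag_apply, mul_apply]
  have h : ((∑ s : Fin m → Fin 4, ‖(A * pauliString s).trace‖ ^ 2 : ℝ) : ℂ) =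
      ((dim m * frobeniusSq A : ℝ) : ℂ) := by
    calc ((∑ s : Fin m → Fin 4, ‖(A * pauliString s).trace‖ ^ 2 : ℝ) : ℂ)
        = ∑ s : Fin m → Fin 4, ∑ x : QubitBasis m × QubitBasis m,
            ∑ y : QubitBasis m × QubitBasis m, A x.1 x.2 * star (A y.1 y.2) *
              (pauliString s x.2 x.1 * star (pauliString s y.2 y.1)) := by
          push_cast
          refine Finset.sum_congr rfl fun s _ => ?_
          rw [← Complex.mul_conj', ← Complex.star_def, htr, star_sum, Finset.sum_mul_sum]
          refine Finset.sum_congr rfl fun x _ => Finset.sum_congr rfl fun y _ => ?_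
          rw [star_mul']
          ring
      _ = ∑ x : QubitBasis m × QubitBasis m, ∑ y : QubitBasis m × QubitBasis m,
            A x.1 x.2 * star (A y.1 y.2) * (if x = y then 2 ^ m else 0) := by
          rw [Finset.sum_comm]
          refine Finset.sum_congr rfl fun x _ => ?_
          rw [Finset.sum_comm]
          refine Finset.sum_congr rfl fun y _ => ?_
          rw [← Finset.mul_sum, pauliString_completeness]
          simp only [Prod.ext_iff]
      _ = _ := by
          simp only [mul_ite, mul_zero, Finset.sum_ite_eq, Finset.mem_univ, if_true]
          rw [Fintype.sum_prod_type, frobeniusSq, dim]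
          push_cast
          simp_rw [Finset.mul_sum]
          refine Finset.sum_congr rfl fun a _ => Finset.sum_congr rfl fun b _ => ?_
          rw [Complex.star_def, Complex.mul_conj', mul_comm]
  exact_mod_cast h

lemma re_trace_mul_eq {A X : QubitOp m} (hA : A.IsHermitian) (hX : X.IsHermitian) :
    ‖(A * X).trace‖ ^ 2 = (A * X).trace.re ^ 2 := by
  have h : star (A * X).trace = (A * X).trace := by
    rw [← trace_conjTranspose, conjTranspose_mul, hA.eq, hX.eq, trace_mul_comm]
  have h' : (((A * X).trace.re : ℝ) : ℂ) = (A * X).trace := Complex.conj_eq_iff_re.1 h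
  conv_lhs => rw [← h', Complex.norm_real, Real.norm_eq_abs, sq_abs]

/-- The identity's coefficient is the trace, which vanishes, so the operators actually measured
suffice. -/
lemma sum_sq_trace_pauliString {A : QubitOp m} (hA : A.IsHermitian) (hA₀ : A.trace = 0) :
    ∑ s : PauliIndex m, (A * pauliString s.1).trace.re ^ 2 = dim m * frobeniusSq A := by
  rw [← sum_normSq_trace_mul_pauliString]
  simp_rw [re_trace_mul_eq hA (pauliString_isHermitian _)]
  rw [← Finset.sum_subtype (Finset.univ.erase (0 : Fin m → Fin 4)) (by simp)
    (fun s => (A * pauliString s).trace.re ^ 2), ← Finset.add_sum_erase _ _ (Finset.mem_univ 0),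
    pauliString_zero]
  simp [hA₀]

lemma card_pauliIndex : (Fintype.card (PauliIndex m) : ℝ) = dim m ^ 2 - 1 := by
  have h := Fintype.card_subtype_compl (fun s : Fin m → Fin 4 => s = 0)
  rw [Fintype.card_subtype_eq, Fintype.card_fun, Fintype.card_fin, Fintype.card_fin] at h
  have h' : Fintype.card (PauliIndex m) = 4 ^ m - 1 := by
    rw [← h]
  rw [h', Nat.cast_sub (Nat.one_le_pow _ _ (by norm_num)), dim, ← pow_mul, mul_comm m 2, pow_mul]
  norm_num

lemma two_le_dim (hm : 1 ≤ m) : 2 ≤ dim m := by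
  rw [dim]
  exact le_self_pow₀ (by norm_num) (by omega)

end Pauli

/-! ### Moments of the binomial distribution -/

section Binomial

variable {N : ℕ}

lemma binomialMass_eq (N : ℕ) (p : ℝ) (k : ℕ) :
    binomialMass N p k = (bernsteinPolynomial ℝ N k).eval p := by
  simp [binomialMass, bernsteinPolynomial]

lemma binomialMass_nonneg {p : ℝ} (h₀ : 0 ≤ p) (h₁ : p ≤ 1) (k : ℕ) : 0 ≤ binomialMass N p k := by
  have := sub_nonneg.2 h₁
  unfold binomialMass
  positivity

lemma sum_binomialMass (p : ℝ) : ∑ k ∈ Finset.range (N + 1), binomialMass N p k = 1 := by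
  simp_rw [binomialMass_eq, ← Polynomial.eval_finsetSum, bernsteinPolynomial.sum,
    Polynomial.eval_one]

lemma sum_binomialMass_mul (p : ℝ) :
    ∑ k ∈ Finset.range (N + 1), binomialMass N p k * k = N * p := by
  have h := congrArg (Polynomial.eval p) (bernsteinPolynomial.sum_smul ℝ N)
  simp only [Polynomial.eval_finsetSum, nsmul_eq_mul, Polynomial.eval_mul, Polynomial.eval_natCast,
    Polynomial.eval_X, ← binomialMass_eq] at h
  simpa only [mul_comm] using h

lemma sum_binomialMass_mul_sq (p : ℝ) :
    ∑ k ∈ Finset.range (N + 1), binomialMass N p k * (N * p - k) ^ 2 = N * p * (1 - p) := by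
  have h := congrArg (Polynomial.eval p) (bernsteinPolynomial.variance ℝ N)
  simp only [Polynomial.eval_finsetSum, nsmul_eq_mul, Polynomial.eval_mul, Polynomial.eval_natCast,
    Polynomial.eval_X, Polynomial.eval_pow, Polynomial.eval_sub, Polynomial.eval_one,
    ← binomialMass_eq] at h
  simpa only [mul_comm] using h

/-- Mean and variance of the observed average, packaged for a quadratic test function. -/
lemma sum_binomialMass_mul_quadratic (hN : 1 ≤ N) (y x C B A : ℝ) :
    ∑ k ∈ Finset.range (N + 1), binomialMass N ((1 + y) / 2) k *
        (C + B * (x - outcomeAverage N k) + A * (x - outcomeAverage N k) ^ 2) =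
      C + B * (x - y) + A * ((x - y) ^ 2 + (1 - y ^ 2) / N) := by
  have hN' : (N : ℝ) ≠ 0 := by positivity
  set p : ℝ := (1 + y) / 2 with hp
  have hy : y = 2 * p - 1 := by rw [hp]; ring
  have h0 := sum_binomialMass (N := N) p
  have h1 := sum_binomialMass_mul (N := N) p
  have h2 := sum_binomialMass_mul_sq (N := N) p
  have h3 : ∑ k ∈ Finset.range (N + 1), binomialMass N p k * (N * p - k) = 0 := by
    simp_rw [mul_sub, Finset.sum_sub_distrib, ← Finset.sum_mul]
    rw [h0, h1]
    ring
  -- Expansion around the mean: `x - ŷ = (x - y) + (2 / N) (N p - k)`.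
  have hk (k : ℕ) : binomialMass N p k *
      (C + B * (x - outcomeAverage N k) + A * (x - outcomeAverage N k) ^ 2) =
      (C + B * (x - y) + A * (x - y) ^ 2) * binomialMass N p k +
        (2 / N * B + 4 / N * A * (x - y)) * (binomialMass N p k * (N * p - k)) +
        4 / N ^ 2 * A * (binomialMass N p k * (N * p - k) ^ 2) := by
    rw [outcomeAverage, hy]
    field_simp
    ring
  simp_rw [hk, Finset.sum_add_distrib, ← Finset.mul_sum]
  rw [h0, h2, h3, hy]
  field_simp
  ring

end Binomial

/-! ### Expected decrease of the potential in one step -/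

section OneStep

open Matrix

variable {m N : ℕ}

/-- The part of the quantum relative entropy of `ρ` and `σ` that depends on `σ`. -/
noncomputable def crossEntropy (ρ σ : QubitOp m) : ℝ := -(ρ * cfc Real.log σ).trace.re

lemma upProb_eq {ρ : QubitOp m} (hρ : ρ.trace = 1) (X : QubitOp m) :
    upProb ρ X = (1 + (ρ * X).trace.re) / 2 := by
  rw [upProb, upProjector, mul_smul_comm, trace_smul, mul_add, mul_one, trace_add, hρ,
    Complex.smul_re, Complex.add_re, Complex.one_re, smul_eq_mul]
  ring

lemma upProb_mem {ρ : QubitOp m} (hρ : IsState ρ) (s : Fin m → Fin 4) :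
    0 ≤ upProb ρ (pauliString s) ∧ upProb ρ (pauliString s) ≤ 1 := by
  have h := abs_le.1 (abs_trace_mul_le_one hρ.1 hρ.2 (pauliString_isHermitian s)
    (pauliString_mul_self s))
  rw [upProb_eq hρ.2]
  constructor <;> linarith [h.1, h.2]

lemma update_posDef (σ : QubitOp m) {X : QubitOp m} (hX : X.IsHermitian) (y η : ℝ) :
    (update σ X y η).PosDef :=
  gibbs_posDef (isHermitian_cfc_log_sub_smul σ hX _)

lemma update_trace (σ : QubitOp m) {X : QubitOp m} (hX : X.IsHermitian) (y η : ℝ) :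
    (update σ X y η).trace = 1 :=
  gibbs_trace (isHermitian_cfc_log_sub_smul σ hX _)

lemma crossEntropy_nonneg {ρ σ : QubitOp m} (hρ : IsState ρ) (hσ : σ.PosDef)
    (hσ₁ : σ.trace = 1) : 0 ≤ crossEntropy ρ σ :=
  neg_nonneg.2 (trace_mul_log_nonpos hρ.1 hσ hσ₁)

/-- The change is exactly `a tr (ρ X) + log Z`. The bound is arranged as a quadratic in `x - y`,
ready for averaging over the outcome. -/
lemma crossEntropy_update_le {ρ σ X : QubitOp m} (hρ : IsState ρ) (hσ : σ.PosDef)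
    (hσ₁ : σ.trace = 1) (hX : X.IsHermitian) (hX₁ : X * X = 1) (y η : ℝ) :
    crossEntropy ρ (update σ X y η) ≤ crossEntropy ρ σ +
      -(2 * η * ((σ * X).trace.re - (ρ * X).trace.re)) * ((σ * X).trace.re - y) +
      4 * η ^ 2 * ((σ * X).trace.re - y) ^ 2 := by
  set a : ℝ := 2 * η * ((σ * X).trace.re - y) with ha
  have hlog : cfc Real.log (update σ X y η) = cfc Real.log σ - a • X -
      Real.log (NormedSpace.exp (cfc Real.log σ - a • X)).trace.re • (1 : QubitOp m) :=
    cfc_log_gibbs (isHermitian_cfc_log_sub_smul σ hX a)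
  have hle := log_trace_exp_le hσ hσ₁ hX hX₁ a
  rw [crossEntropy, hlog, mul_sub, mul_sub, mul_smul_comm, mul_smul_comm, mul_one, trace_sub,
    trace_sub, trace_smul, trace_smul, hρ.2, Complex.sub_re, Complex.sub_re, Complex.smul_re,
    Complex.smul_re, Complex.one_re, smul_eq_mul, smul_eq_mul, crossEntropy]
  have h1 : a * (ρ * X).trace.re - a * (σ * X).trace.re + a ^ 2 =
      -(2 * η * ((σ * X).trace.re - (ρ * X).trace.re)) * ((σ * X).trace.re - y) +
      4 * η ^ 2 * ((σ * X).trace.re - y) ^ 2 := by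
    rw [ha]
    ring
  linarith

lemma frobeniusSq_nonneg (A : QubitOp m) : 0 ≤ frobeniusSq A := by
  unfold frobeniusSq
  positivity

lemma sum_sq_trace_sub {ρ σ : QubitOp m} (hρ : IsState ρ) (hσ : IsState σ) :
    ∑ s : PauliIndex m,
      ((σ * pauliString s.1).trace.re - (ρ * pauliString s.1).trace.re) ^ 2 =
      dim m * frobeniusSq (σ - ρ) := by
  rw [← sum_sq_trace_pauliString (hσ.1.isHermitian.sub hρ.1.isHermitian)
    (by rw [trace_sub, hσ.2, hρ.2, sub_self])]
  simp_rw [sub_mul, trace_sub, Complex.sub_re]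

/-- Crude, but any uniform bound serves: it only keeps the gain constant `K` independent of time. -/
lemma frobeniusSq_sub_le (hm : 1 ≤ m) {ρ σ : QubitOp m} (hρ : IsState ρ) (hσ : IsState σ) :
    frobeniusSq (σ - ρ) ≤ 4 * (dim m ^ 2 - 1) := by
  have hd := two_le_dim hm
  have h : dim m * frobeniusSq (σ - ρ) ≤ ∑ _s : PauliIndex m, (4 : ℝ) := by
    rw [← sum_sq_trace_sub hρ hσ]
    refine Finset.sum_le_sum fun s _ => ?_
    have h1 := abs_le.1 (abs_trace_mul_le_one hρ.1 hρ.2 (pauliString_isHermitian s.1)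
      (pauliString_mul_self s.1))
    have h2 := abs_le.1 (abs_trace_mul_le_one hσ.1 hσ.2 (pauliString_isHermitian s.1)
      (pauliString_mul_self s.1))
    nlinarith [h1.1, h1.2, h2.1, h2.2]
  rw [Finset.sum_const, Finset.card_univ, nsmul_eq_mul, card_pauliIndex] at h
  nlinarith [frobeniusSq_nonneg (σ - ρ)]

/-- The mean of a function of the measured label and the number of "up" outcomes in one step. -/
noncomputable def stepMean (ρ : QubitOp m) (N : ℕ) (f : PauliIndex m → ℕ → ℝ) : ℝ :=
  ∑ s : PauliIndex m, ∑ k ∈ Finset.range (N + 1),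
    1 / (dim m ^ 2 - 1) * binomialMass N (upProb ρ (pauliString s.1)) k * f s k

/-- The bound is affine in the squared error, so for a deterministic `η` its expectation involves
only the mean squared error. -/
lemma stepMean_crossEntropy_update_le (hm : 1 ≤ m) (hN : 1 ≤ N) {ρ σ : QubitOp m}
    (hρ : IsState ρ) (hσ : σ.PosDef) (hσ₁ : σ.trace = 1) (η : ℝ) :
    stepMean ρ N (fun s k => crossEntropy ρ (update σ (pauliString s.1) (outcomeAverage N k) η)) ≤
      crossEntropy ρ σ + dim m / (dim m ^ 2 - 1) * (-(2 * η) * frobeniusSq (σ - ρ) +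
        4 * η ^ 2 * (frobeniusSq (σ - ρ) + (dim m ^ 2 - 1) / (N * dim m))) := by
  have hd := two_le_dim hm
  have hD : 0 < dim m ^ 2 - 1 := by nlinarith
  have hN' : (0 : ℝ) < N := by exact_mod_cast hN
  have hstep (s : PauliIndex m) : ∑ k ∈ Finset.range (N + 1),
      binomialMass N (upProb ρ (pauliString s.1)) k *
        crossEntropy ρ (update σ (pauliString s.1) (outcomeAverage N k) η) ≤
      crossEntropy ρ σ + 4 * η ^ 2 / N + (4 * η ^ 2 - 2 * η) *
        ((σ * pauliString s.1).trace.re - (ρ * pauliString s.1).trace.re) ^ 2 := by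
    set x := (σ * pauliString s.1).trace.re
    set y := (ρ * pauliString s.1).trace.re
    have hp := upProb_mem hρ s.1
    calc _ ≤ ∑ k ∈ Finset.range (N + 1), binomialMass N (upProb ρ (pauliString s.1)) k *
          (crossEntropy ρ σ + -(2 * η * (x - y)) * (x - outcomeAverage N k) +
            4 * η ^ 2 * (x - outcomeAverage N k) ^ 2) := by
          refine Finset.sum_le_sum fun k _ => mul_le_mul_of_nonneg_left ?_
            (binomialMass_nonneg hp.1 hp.2 k)
          exact crossEntropy_update_le hρ hσ hσ₁ (pauliString_isHermitian s.1)
            (pauliString_mul_self s.1) _ η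
      _ = crossEntropy ρ σ + -(2 * η * (x - y)) * (x - y) +
            4 * η ^ 2 * ((x - y) ^ 2 + (1 - y ^ 2) / N) := by
          rw [upProb_eq hρ.2, sum_binomialMass_mul_quadratic hN]
      _ ≤ crossEntropy ρ σ + -(2 * η * (x - y)) * (x - y) +
            4 * η ^ 2 * ((x - y) ^ 2 + 1 / N) := by
          gcongr
          nlinarith [sq_nonneg y]
      _ = _ := by ring
  calc _ = 1 / (dim m ^ 2 - 1) * ∑ s : PauliIndex m, ∑ k ∈ Finset.range (N + 1),
        binomialMass N (upProb ρ (pauliString s.1)) k *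
          crossEntropy ρ (update σ (pauliString s.1) (outcomeAverage N k) η) := by
        simp_rw [stepMean, Finset.mul_sum, mul_assoc]
    _ ≤ 1 / (dim m ^ 2 - 1) * ∑ s : PauliIndex m,
        (crossEntropy ρ σ + 4 * η ^ 2 / N + (4 * η ^ 2 - 2 * η) *
          ((σ * pauliString s.1).trace.re - (ρ * pauliString s.1).trace.re) ^ 2) := by
        gcongr with s _
        exact hstep s
    _ = _ := by
        rw [Finset.sum_add_distrib, ← Finset.mul_sum, sum_sq_trace_sub hρ ⟨hσ.posSemidef, hσ₁⟩,
          Finset.sum_const, Finset.card_univ, nsmul_eq_mul, card_pauliIndex]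
        field_simp
        ring

/-- With the adaptive rate the mean decrease of the potential is quadratic in the mean error. -/
lemma adaptiveRate_gain (hm : 1 ≤ m) (hN : 1 ≤ N) :
    ∃ K : ℝ, 0 < K ∧ ∀ e : ℝ, 0 ≤ e → e ≤ 4 * (dim m ^ 2 - 1) →
      dim m / (dim m ^ 2 - 1) * (-(2 * adaptiveRate m N e) * e +
        4 * adaptiveRate m N e ^ 2 * (e + (dim m ^ 2 - 1) / (N * dim m))) ≤ -(K * e ^ 2) := by
  have hd := two_le_dim hm
  have hD : 0 < dim m ^ 2 - 1 := by nlinarith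
  have hd0 : 0 < dim m := by linarith
  have hN' : (0 : ℝ) < N := by exact_mod_cast hN
  set c : ℝ := (dim m ^ 2 - 1) / (N * dim m) with hc
  have hc0 : 0 < c := by positivity
  set M : ℝ := 4 * (dim m ^ 2 - 1) with hM
  have hM0 : 0 < M := by positivity
  refine ⟨dim m / (dim m ^ 2 - 1) * (c / (M + 2 * c) ^ 2), by positivity, fun e he heM => ?_⟩
  -- The quadratic in `η` is negative up to `e / (2 (e + c))`; the rate `e / (2 (e + 2 c))` stays
  -- below that. Bounding `e` by `M` in the denominator then gives `K`.
  have h : -(2 * adaptiveRate m N e) * e + 4 * adaptiveRate m N e ^ 2 * (e + c) =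
      -(c / (e + 2 * c) ^ 2 * e ^ 2) := by
    rw [adaptiveRate, ← hc]
    field_simp
    ring
  rw [h, mul_neg, neg_le_neg_iff, mul_assoc]
  gcongr

end OneStep

/-! ### The random process and its mean squared error -/

section Convergence

open Matrix

variable {m N : ℕ} {Ω : Type*} [MeasurableSpace Ω] {μ : Measure Ω} {ρ ρ₁ : QubitOp m}
  {choice : ℕ → Ω → PauliIndex m} {up : ℕ → Ω → ℕ}

lemma estimate_posDef_and_trace (hρ₁ : IsState ρ₁) (hρ₁pos : ρ₁.PosDef) (t : ℕ) (ω : Ω) :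
    (estimate μ ρ ρ₁ N choice up t ω).PosDef ∧
      (estimate μ ρ ρ₁ N choice up t ω).trace = 1 := by
  cases t with
  | zero => exact ⟨hρ₁pos, hρ₁.2⟩
  | succ t =>
    exact ⟨update_posDef _ (pauliString_isHermitian _) _ _,
      update_trace _ (pauliString_isHermitian _) _ _⟩

/-- Counts above `N` have mass zero because the binomial coefficient vanishes. -/
lemma IsPauliMeasurementSequence.up_le (h : IsPauliMeasurementSequence μ ρ N choice up) (t : ℕ) :
    ∀ᵐ ω ∂μ, up t ω ≤ N := by
  have h0 : ∀ k : ℕ, ∀ s : PauliIndex m, ∀ᵐ ω ∂μ, N < k → ¬(choice t ω = s ∧ up t ω = k) := by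
    intro k s
    rcases lt_or_ge N k with hk | hk
    · have : μ {ω | choice t ω = s ∧ up t ω = k} = 0 := by
        rw [h.law, binomialMass, Nat.choose_eq_zero_of_lt hk]
        simp
      filter_upwards [measure_eq_zero_iff_ae_notMem.1 this] with ω hω _ using hω
    · exact Eventually.of_forall fun ω hk' => absurd hk' (not_lt.2 hk)
  filter_upwards [ae_all_iff.2 fun k => ae_all_iff.2 (h0 k)] with ω hω
  by_contra! hlt
  exact hω _ _ hlt ⟨rfl, rfl⟩

/-- This makes every real function of the estimate integrable, with no continuity argument for the
matrix functions. -/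
lemma IsPauliMeasurementSequence.exists_finite_range
    (h : IsPauliMeasurementSequence μ ρ N choice up) (ρ₁ : QubitOp m) (t : ℕ) :
    ∃ V : Set (QubitOp m), V.Finite ∧ ∀ᵐ ω ∂μ, estimate μ ρ ρ₁ N choice up t ω ∈ V := by
  induction t with
  | zero => exact ⟨{ρ₁}, Set.finite_singleton _, Eventually.of_forall fun _ => rfl⟩
  | succ t ih =>
    obtain ⟨V, hV, hmem⟩ := ih
    refine ⟨(fun x : QubitOp m × PauliIndex m × ℕ => update x.1 (pauliString x.2.1.1)
      (outcomeAverage N x.2.2) (adaptiveRate m N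
        (∫ ω', frobeniusSq (estimate μ ρ ρ₁ N choice up t ω' - ρ) ∂μ))) ''
        (V ×ˢ (Set.univ ×ˢ Set.Iic N)),
      (hV.prod (Set.finite_univ.prod (Set.finite_Iic N))).image _, ?_⟩
    filter_upwards [hmem, h.up_le t] with ω hω hup
    exact ⟨(_, choice t ω, up t ω), ⟨hω, trivial, hup⟩, rfl⟩

/-- The rate is deterministic, so the estimate depends only on steps before `t`. Histories form a
countable discrete space, which gives measurability; step `t` is not among them, which gives
independence. -/
lemma exists_estimate_eq_comp_history (μ : Measure Ω) (ρ ρ₁ : QubitOp m) (N : ℕ)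
    (choice : ℕ → Ω → PauliIndex m) (up : ℕ → Ω → ℕ) (t : ℕ) :
    ∃ F : (Finset.range t → PauliIndex m × ℕ) → QubitOp m,
      ∀ ω, estimate μ ρ ρ₁ N choice up t ω = F fun i => (choice i ω, up i ω) := by
  induction t with
  | zero => exact ⟨fun _ => ρ₁, fun _ => rfl⟩
  | succ t ih =>
    obtain ⟨F, hF⟩ := ih
    refine ⟨fun z => update
      (F fun i => z ⟨i, Finset.mem_range.2 ((Finset.mem_range.1 i.2).trans t.lt_succ_self)⟩)
      (pauliString (z ⟨t, Finset.self_mem_range_succ t⟩).1.1)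
      (outcomeAverage N (z ⟨t, Finset.self_mem_range_succ t⟩).2)
      (adaptiveRate m N (∫ ω', frobeniusSq (estimate μ ρ ρ₁ N choice up t ω' - ρ) ∂μ)),
      fun ω => ?_⟩
    change update (estimate μ ρ ρ₁ N choice up t ω) _ _ _ = _
    rw [hF ω]

lemma IsPauliMeasurementSequence.measurable_pair
    (h : IsPauliMeasurementSequence μ ρ N choice up) (t : ℕ) :
    Measurable fun ω => (choice t ω, up t ω) :=
  (h.measurable_choice t).prodMk (h.measurable_up t)

lemma IsPauliMeasurementSequence.measurable_comp_estimate
    (h : IsPauliMeasurementSequence μ ρ N choice up) (ρ₁ : QubitOp m) (t : ℕ)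
    (f : QubitOp m → ℝ) : Measurable fun ω => f (estimate μ ρ ρ₁ N choice up t ω) := by
  obtain ⟨F, hF⟩ := exists_estimate_eq_comp_history μ ρ ρ₁ N choice up t
  simp_rw [hF]
  exact (Measurable.of_discrete (f := fun z => f (F z))).comp
    (measurable_pi_lambda _ fun i => h.measurable_pair i)

lemma IsPauliMeasurementSequence.indepFun_estimate
    (h : IsPauliMeasurementSequence μ ρ N choice up) (ρ₁ : QubitOp m) (t : ℕ)
    (f : QubitOp m → ℝ) (g : PauliIndex m × ℕ → ℝ) :
    IndepFun (fun ω => g (choice t ω, up t ω))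
      (fun ω => f (estimate μ ρ ρ₁ N choice up t ω)) μ := by
  obtain ⟨F, hF⟩ := exists_estimate_eq_comp_history μ ρ ρ₁ N choice up t
  simp_rw [hF]
  have hi := h.indep.indepFun_finset {t} (Finset.range t) (by simp) h.measurable_pair
  exact hi.comp
    (φ := fun z : ({t} : Finset ℕ) → PauliIndex m × ℕ => g (z ⟨t, Finset.mem_singleton_self t⟩))
    (ψ := fun z => f (F z))
    (Measurable.of_discrete.comp (measurable_pi_apply _)) Measurable.of_discrete

variable [IsProbabilityMeasure μ]

lemma IsPauliMeasurementSequence.integrable_comp_estimate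
    (h : IsPauliMeasurementSequence μ ρ N choice up) (ρ₁ : QubitOp m) (t : ℕ)
    (f : QubitOp m → ℝ) : Integrable (fun ω => f (estimate μ ρ ρ₁ N choice up t ω)) μ := by
  obtain ⟨V, hV, hmem⟩ := h.exists_finite_range ρ₁ t
  obtain ⟨C, hC⟩ := (hV.image fun σ => ‖f σ‖).bddAbove
  refine Integrable.of_bound (h.measurable_comp_estimate ρ₁ t f).aestronglyMeasurable C ?_
  filter_upwards [hmem] with ω hω
  exact hC ⟨_, hω, rfl⟩

/-- Conditioning one step of the process on the past. -/
lemma IsPauliMeasurementSequence.integral_step (hm : 1 ≤ m)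
    (h : IsPauliMeasurementSequence μ ρ N choice up) (hρ : IsState ρ) (ρ₁ : QubitOp m) (t : ℕ)
    (f : QubitOp m → PauliIndex m → ℕ → ℝ) :
    ∫ ω, f (estimate μ ρ ρ₁ N choice up t ω) (choice t ω) (up t ω) ∂μ =
      ∫ ω, stepMean ρ N (f (estimate μ ρ ρ₁ N choice up t ω)) ∂μ := by
  classical
  set E := estimate μ ρ ρ₁ N choice up t
  let g : PauliIndex m × ℕ → PauliIndex m × ℕ → ℝ := fun z => Set.indicator {z} 1
  -- Splitting over the value of the pair leaves products of an indicator of step `t` with a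
  -- function of the past, to which independence applies.
  have hae : ∀ᵐ ω ∂μ, f (E ω) (choice t ω) (up t ω) = ∑ s, ∑ k ∈ Finset.range (N + 1),
      g (s, k) (choice t ω, up t ω) * f (E ω) s k := by
    filter_upwards [h.up_le t] with ω hω
    rw [Finset.sum_eq_single (choice t ω), Finset.sum_eq_single (up t ω)]
    · simp [g]
    · intro k _ hk
      simp [g, hk.symm]
    · intro hk
      exact absurd (Finset.mem_range.2 (Nat.lt_succ_of_le hω)) hk
    · intro s _ hs
      refine Finset.sum_eq_zero fun k _ => ?_
      simp [g, hs.symm]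
    · simp
  have hgm (z) : Measurable fun ω => g z (choice t ω, up t ω) :=
    (Measurable.of_discrete (f := g z)).comp (h.measurable_pair t)
  have hgi (z) : Integrable (fun ω => g z (choice t ω, up t ω)) μ := by
    refine Integrable.of_bound (hgm z).aestronglyMeasurable 1 (Eventually.of_forall fun ω => ?_)
    simp only [g, Set.indicator]
    split_ifs <;> simp
  have hgint (s : PauliIndex m) (k : ℕ) : ∫ ω, g (s, k) (choice t ω, up t ω) ∂μ =
      1 / (dim m ^ 2 - 1) * binomialMass N (upProb ρ (pauliString s.1)) k := by
    have hd := two_le_dim hm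
    have hD : 0 < dim m ^ 2 - 1 := by nlinarith
    have hp := upProb_mem hρ s.1
    have hb := binomialMass_nonneg (N := N) hp.1 hp.2 k
    have hset : {ω | choice t ω = s ∧ up t ω = k} =
        (fun ω => (choice t ω, up t ω)) ⁻¹' {(s, k)} := by
      ext ω
      simp
    have hms : MeasurableSet {ω | choice t ω = s ∧ up t ω = k} := by
      rw [hset]
      exact h.measurable_pair t (measurableSet_singleton _)
    have hfun : (fun ω => g (s, k) (choice t ω, up t ω)) =
        Set.indicator {ω | choice t ω = s ∧ up t ω = k} 1 := by
      rw [hset]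
      rfl
    rw [hfun, integral_indicator_one hms, measureReal_def, h.law,
      ENNReal.toReal_ofReal (by positivity)]
  have hfi (s : PauliIndex m) (k : ℕ) : Integrable (fun ω => f (E ω) s k) μ :=
    h.integrable_comp_estimate ρ₁ t fun σ => f σ s k
  have hind (s : PauliIndex m) (k : ℕ) :=
    h.indepFun_estimate ρ₁ t (fun σ => f σ s k) (g (s, k))
  have hgfi (s : PauliIndex m) (k : ℕ) :
      Integrable (fun ω => g (s, k) (choice t ω, up t ω) * f (E ω) s k) μ :=
    (hind s k).integrable_mul (hgi (s, k)) (hfi s k)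
  rw [integral_congr_ae hae, integral_finsetSum _ fun s _ => integrable_finsetSum _ fun k _ =>
    hgfi s k]
  simp only [stepMean]
  rw [integral_finsetSum _ fun s _ => integrable_finsetSum _ fun k _ => (hfi s k).const_mul _]
  refine Finset.sum_congr rfl fun s _ => ?_
  rw [integral_finsetSum _ fun k _ => hgfi s k,
    integral_finsetSum _ fun k _ => (hfi s k).const_mul _]
  refine Finset.sum_congr rfl fun k _ => ?_
  rw [integral_const_mul, ← hgint]
  exact (hind s k).integral_fun_mul_eq_mul_integral (hgm (s, k)).aestronglyMeasurable
    (hfi s k).aestronglyMeasurable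

/-- Telescoping bounds `K ∑ e t ^ 2` by `Φ 0`, so the squares are summable. -/
lemma tendsto_zero_of_sq_le_decrease {e Φ : ℕ → ℝ} {K : ℝ} (hK : 0 < K) (hΦ : ∀ t, 0 ≤ Φ t)
    (h : ∀ t, Φ (t + 1) ≤ Φ t - K * e t ^ 2) : Tendsto e atTop (𝓝 0) := by
  have hsum (n : ℕ) : ∑ t ∈ Finset.range n, e t ^ 2 ≤ Φ 0 / K := by
    have h1 : K * ∑ t ∈ Finset.range n, e t ^ 2 ≤ Φ 0 - Φ n := by
      rw [Finset.mul_sum, ← Finset.sum_range_sub' Φ]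
      exact Finset.sum_le_sum fun t _ => by linarith [h t]
    rw [le_div_iff₀' hK]
    linarith [hΦ n]
  have hs := summable_of_sum_range_le (fun t => sq_nonneg (e t)) hsum
  have ht := hs.tendsto_atTop_zero
  have habs : Tendsto (fun t => |e t|) atTop (𝓝 0) := by
    simpa [Real.sqrt_sq_eq_abs] using ht.sqrt
  exact (tendsto_zero_iff_abs_tendsto_zero _).2 habs

theorem IsPauliMeasurementSequence.tendsto_meanSquaredError (hm : 1 ≤ m) (hN : 1 ≤ N)
    (h : IsPauliMeasurementSequence μ ρ N choice up) (hρ : IsState ρ) (hρ₁ : IsState ρ₁)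
    (hρ₁pos : ρ₁.PosDef) :
    Tendsto (fun t => ∫ ω, frobeniusSq (estimate μ ρ ρ₁ N choice up t ω - ρ) ∂μ)
      atTop (𝓝 0) := by
  obtain ⟨K, hK, hgain⟩ := adaptiveRate_gain hm hN
  have hst := estimate_posDef_and_trace (μ := μ) (ρ := ρ) (N := N) (choice := choice) (up := up)
    hρ₁ hρ₁pos
  refine tendsto_zero_of_sq_le_decrease hK
    (Φ := fun t => ∫ ω, crossEntropy ρ (estimate μ ρ ρ₁ N choice up t ω) ∂μ)
    (fun t => integral_nonneg fun ω => crossEntropy_nonneg hρ (hst t ω).1 (hst t ω).2)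
    fun t => ?_
  set e := ∫ ω, frobeniusSq (estimate μ ρ ρ₁ N choice up t ω - ρ) ∂μ with he
  have hint := h.integrable_comp_estimate ρ₁ t
  have hF := hint fun σ => frobeniusSq (σ - ρ)
  have he0 : 0 ≤ e := integral_nonneg fun ω => frobeniusSq_nonneg _
  have heM : e ≤ 4 * (dim m ^ 2 - 1) := by
    have := integral_mono hF (integrable_const (4 * (dim m ^ 2 - 1)))
      fun ω => frobeniusSq_sub_le hm hρ ⟨(hst t ω).1.posSemidef, (hst t ω).2⟩
    simpa using this
  set η := adaptiveRate m N e
  set κ := dim m / (dim m ^ 2 - 1)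
  set c := (dim m ^ 2 - 1) / (N * dim m)
  have hlin : Integrable (fun ω => κ * (-(2 * η) + 4 * η ^ 2) *
      frobeniusSq (estimate μ ρ ρ₁ N choice up t ω - ρ) + κ * (4 * η ^ 2 * c)) μ :=
    (hF.const_mul _).add (integrable_const _)
  calc ∫ ω, crossEntropy ρ (estimate μ ρ ρ₁ N choice up (t + 1) ω) ∂μ
      = ∫ ω, stepMean ρ N (fun s k => crossEntropy ρ (update (estimate μ ρ ρ₁ N choice up t ω)
          (pauliString s.1) (outcomeAverage N k) η)) ∂μ :=
        h.integral_step hm hρ ρ₁ t fun σ s k =>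
          crossEntropy ρ (update σ (pauliString s.1) (outcomeAverage N k) η)
    _ ≤ ∫ ω, (crossEntropy ρ (estimate μ ρ ρ₁ N choice up t ω) +
          (κ * (-(2 * η) + 4 * η ^ 2) * frobeniusSq (estimate μ ρ ρ₁ N choice up t ω - ρ) +
            κ * (4 * η ^ 2 * c))) ∂μ := by
        refine integral_mono (hint fun σ => stepMean ρ N fun s k =>
            crossEntropy ρ (update σ (pauliString s.1) (outcomeAverage N k) η))
          ((hint (crossEntropy ρ)).add hlin) fun ω => ?_
        refine (stepMean_crossEntropy_update_le hm hN hρ (hst t ω).1 (hst t ω).2 η).trans_eq ?_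
        ring
    _ = ∫ ω, crossEntropy ρ (estimate μ ρ ρ₁ N choice up t ω) ∂μ +
          κ * (-(2 * η) * e + 4 * η ^ 2 * (e + c)) := by
        rw [integral_add (hint (crossEntropy ρ)) hlin,
          integral_add (hF.const_mul _) (integrable_const _), integral_const_mul, integral_const]
        simp only [probReal_univ, one_smul]
        rw [← he]
        ring
    _ ≤ _ := by linarith [hgain e he0 heM]

end Convergence

end MEG

theorem mainTheorem4 {m : ℕ} (hm : 1 ≤ m) {N : ℕ} (hN : 1 ≤ N)
    {Ω : Type*} [MeasurableSpace Ω] (μ : Measure Ω) [IsProbabilityMeasure μ]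
    (ρ : MEG.QubitOp m) (hρ : MEG.IsState ρ)
    (ρ₁ : MEG.QubitOp m) (hρ₁ : MEG.IsState ρ₁) (hρ₁pos : ρ₁.PosDef)
    (choice : ℕ → Ω → MEG.PauliIndex m) (up : ℕ → Ω → ℕ)
    (hmeas : MEG.IsPauliMeasurementSequence μ ρ N choice up) :
    ∀ δ : ℝ, 0 < δ →
      Tendsto
        (fun t => μ {ω | MEG.frobeniusSq (MEG.estimate μ ρ ρ₁ N choice up t ω - ρ) ≤ δ})
        atTop (𝓝 1) := by
  intro δ hδ
  have hlim := hmeas.tendsto_meanSquaredError hm hN hρ hρ₁ hρ₁pos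
  set F : ℕ → Ω → ℝ := fun t ω => MEG.frobeniusSq (MEG.estimate μ ρ ρ₁ N choice up t ω - ρ)
  have hFm (t : ℕ) : Measurable (F t) :=
    hmeas.measurable_comp_estimate ρ₁ t fun σ => MEG.frobeniusSq (σ - ρ)
  have hFi (t : ℕ) : Integrable (F t) μ :=
    hmeas.integrable_comp_estimate ρ₁ t fun σ => MEG.frobeniusSq (σ - ρ)
  -- Markov's inequality.
  have hbad (t : ℕ) : μ {ω | δ ≤ F t ω} ≤ ENNReal.ofReal ((∫ ω, F t ω ∂μ) / δ) := by
    rw [← ofReal_measureReal]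
    refine ENNReal.ofReal_le_ofReal ?_
    rw [le_div_iff₀' hδ]
    exact mul_meas_ge_le_integral_of_nonneg
      (Eventually.of_forall fun ω => MEG.frobeniusSq_nonneg _) (hFi t) δ
  have hzero : Tendsto (fun t => ENNReal.ofReal ((∫ ω, F t ω ∂μ) / δ)) atTop (𝓝 0) := by
    simpa using ENNReal.tendsto_ofReal (hlim.div_const δ)
  have hone : Tendsto (fun t => 1 - ENNReal.ofReal ((∫ ω, F t ω ∂μ) / δ)) atTop (𝓝 1) := by
    simpa using ENNReal.Tendsto.sub (tendsto_const_nhds (x := (1 : ENNReal))) hzero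
      (Or.inl ENNReal.one_ne_top)
  refine tendsto_of_tendsto_of_tendsto_of_le_of_le hone tendsto_const_nhds (fun t => ?_)
    fun t => prob_le_one
  have hgood : MeasurableSet {ω | F t ω ≤ δ} := measurableSet_le (hFm t) measurable_const
  calc 1 - ENNReal.ofReal ((∫ ω, F t ω ∂μ) / δ) ≤ 1 - μ {ω | F t ω ≤ δ}ᶜ := by
        refine tsub_le_tsub_left (le_trans (measure_mono fun ω hω => ?_) (hbad t)) 1
        exact (not_le.1 (show ¬F t ω ≤ δ from hω)).le
    _ = μ {ω | F t ω ≤ δ} := by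
        rw [prob_compl_eq_one_sub hgood, ENNReal.sub_sub_cancel ENNReal.one_ne_top prob_le_one]
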